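/- Let $c_0$ be the real Banach space of real sequences indexed by $\mathbb N$ that tend to zero, with the supremum norm, and for a finite set $F\subset\mathbb N$ let $\chi_F\in c_0$ be its characteristic function. For a real Banach space $X$, an infinite set $I$ and a free ultrafilter $\mathcal U$ on $I$, let $X^{\mathcal U}$ be the ultrapower, that is, the quotient of $\ell_\infty(I,X)$ by the subspace of the families $(x_i)_{i\in I}$ with $\lim_{i,\mathcal U}\|x_i\|=0$; for $K\subset X$ let $K^{\mathcal U}\subset X^{\mathcal U}$ be the set of the classes of the bounded families $(x_i)_{i\in I}$ with $x_i\in K$ for all $i\in I$. A subset $K\subset X$ is called super weakly compact (SWC) if it is weakly closed and $K^{\mathcal U}$ is relatively weakly compact in $X^{\mathcal U}$ for every free ultrafilter $\mathcal U$ on every infinite set. Let $\mathcal F$ be a family of finite subsets of $\mathbb N$ such that $K=\{\chi_F : F\in\mathcal F\}$ is an SWC subset of $c_0$. Then there exist $p\in\mathbb N$ and $C>0$ such that for every nonempty finite set $A\subset\mathbb N$ $$\big|\{F\cap A : F\in\mathcal F\}\big|\le C\,|A|^p .$$ -/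

import Mathlib

open Filter Topology
open scoped ENNReal ZeroAtInfty

/-- The subspace of `ℓ_∞(I, X)` of the families `(x_i)` with `lim_{i, U} ‖x_i‖ = 0`. -/
def nullFamilies {I : Type*} (X : Type*) [NormedAddCommGroup X] [NormedSpace ℝ X]
    (U : Ultrafilter I) : Submodule ℝ (lp (fun _ : I => X) ∞) where
  carrier := {x | Tendsto (fun i => ‖x i‖) (U : Filter I) (𝓝 0)}
  zero_mem' := by simp
  add_mem' := by
    intro x y hx hy
    refine squeeze_zero (fun i => norm_nonneg _) (fun i => ?_) (by simpa using hx.add hy)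
    simpa using norm_add_le (x i) (y i)
  smul_mem' := by
    intro c x hx
    have h := hx.const_mul ‖c‖
    simpa [norm_smul] using h

/-- The ultrapower `X^U`: bounded families in `X` (with the supremum norm) modulo the families
that are null along `U`, with the quotient norm. -/
abbrev BanachUltrapower {I : Type*} (X : Type*) [NormedAddCommGroup X] [NormedSpace ℝ X]
    (U : Ultrafilter I) : Type _ :=
  lp (fun _ : I => X) ∞ ⧸ nullFamilies X U

/-- `K^U`: the classes in `X^U` of the bounded families all of whose members lie in `K`. -/
def setUltrapower {I : Type*} {X : Type*} [NormedAddCommGroup X] [NormedSpace ℝ X]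
    (K : Set X) (U : Ultrafilter I) : Set (BanachUltrapower X U) :=
  (nullFamilies X U).mkQ '' {x | ∀ i, x i ∈ K}

/-- A subset of a real normed space is weakly closed if it is closed in the weak topology. -/
def IsWeaklyClosed {E : Type*} [SeminormedAddCommGroup E] [NormedSpace ℝ E] (S : Set E) : Prop :=
  IsClosed (toWeakSpace ℝ E '' S)

/-- A subset of a real normed space is relatively weakly compact if its closure in the weak
topology is compact in the weak topology. -/
def IsRelativelyWeaklyCompact {E : Type*} [SeminormedAddCommGroup E] [NormedSpace ℝ E]
    (S : Set E) : Prop :=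
  IsCompact (closure (toWeakSpace ℝ E '' S))

/-- A subset `K` of `X` is super weakly compact if it is weakly closed and `K^U` is relatively
weakly compact in `X^U` for every free ultrafilter `U` on every infinite set `I`. -/
def IsSuperWeaklyCompact {X : Type*} [NormedAddCommGroup X] [NormedSpace ℝ X]
    (K : Set X) : Prop :=
  IsWeaklyClosed K ∧
    ∀ (I : Type) [Infinite I] (U : Ultrafilter I), (U : Filter I) ≤ cofinite →
      IsRelativelyWeaklyCompact (setUltrapower K U)

/-- The characteristic function of a finite set `F ⊆ ℕ`, as an element of `c_0 = C₀(ℕ, ℝ)`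
(real sequences that tend to zero, with the supremum norm). -/
def charFun₀ (F : Finset ℕ) : C₀(ℕ, ℝ) where
  toFun n := if n ∈ F then 1 else 0
  continuous_toFun := continuous_of_discreteTopology
  zero_at_infty' := by
    rw [cocompact_eq_cofinite]
    refine tendsto_const_nhds.congr' ?_
    filter_upwards [F.finite_toSet.compl_mem_cofinite] with n hn
    have h : n ∉ F := by simpa using hn
    simp [h]

/-! By Sauer–Shelah, a family shattering no set of more than `d` points has polynomially many
traces. If instead arbitrarily large sets are shattered, then for each n there are points a_i and
members F_j with a_i ∈ F_j iff i ≤ j, for i < n. In an ultrapower, the limits of the evaluations at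
a_i and the classes of the χ_{F_j} form an infinite 0-1 triangular matrix. Its iterated limits are 1
and 0, which Grothendieck's double limit criterion forbids in a relatively weakly compact set. -/

theorem exists_ultrafilter_limit_functional {E ι : Type*} [SeminormedAddCommGroup E]
    [NormedSpace ℝ E] (U : Ultrafilter ι) (g : ι → StrongDual ℝ E) (hg : ∀ i, ‖g i‖ ≤ 1) :
    ∃ f : StrongDual ℝ E, ‖f‖ ≤ 1 ∧ ∀ x, Tendsto (fun i => g i x) U (𝓝 (f x)) := by
  have hc := WeakDual.isCompact_closedBall (𝕜 := ℝ) (0 : StrongDual ℝ E) 1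
  obtain ⟨f, hf, hlim⟩ := hc.ultrafilter_le_nhds'
    (U.map fun i => StrongDual.toWeakDual (g i))
    (Ultrafilter.mem_map.2 (Filter.univ_mem' fun i => by simpa using hg i))
  refine ⟨WeakDual.toStrongDual f, by simpa using hf, fun x => ?_⟩
  exact ((WeakDual.eval_continuous x).tendsto f).comp hlim

theorem tendsto_functional_of_tendsto_toWeakSpace {E ι : Type*} [SeminormedAddCommGroup E]
    [NormedSpace ℝ E] {l : Filter ι} {x : ι → E} {y : E}
    (h : Tendsto (fun i => toWeakSpace ℝ E (x i)) l (𝓝 (toWeakSpace ℝ E y)))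
    (f : StrongDual ℝ E) : Tendsto (fun i => f (x i)) l (𝓝 (f y)) :=
  ((WeakBilin.eval_continuous (topDualPairing ℝ E).flip f).tendsto _).comp h

/-- A relatively weakly compact set contains no sequence that is ordered by a bounded sequence of
functionals. -/
theorem not_isRelativelyWeaklyCompact_of_order {E : Type*} [SeminormedAddCommGroup E]
    [NormedSpace ℝ E] {S : Set E} {x : ℕ → E} (hx : ∀ j, x j ∈ S) {g : ℕ → StrongDual ℝ E}
    (hg : ∀ i, ‖g i‖ ≤ 1) (hgx : ∀ i j, g i (x j) = if i ≤ j then 1 else 0) :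
    ¬ IsRelativelyWeaklyCompact S := by
  intro hS
  obtain ⟨f, -, hf⟩ := exists_ultrafilter_limit_functional (hyperfilter ℕ) g hg
  obtain ⟨w, -, hw⟩ := hS.ultrafilter_le_nhds'
    ((hyperfilter ℕ).map fun j => toWeakSpace ℝ E (x j))
    (Ultrafilter.mem_map.2 (Filter.univ_mem'
      fun j => subset_closure (Set.mem_image_of_mem _ (hx j))))
  obtain ⟨y, rfl⟩ := (toWeakSpace ℝ E).surjective w
  have hlim := fun φ : StrongDual ℝ E => tendsto_functional_of_tendsto_toWeakSpace hw φ
  have hle : ((hyperfilter ℕ : Ultrafilter ℕ) : Filter ℕ) ≤ atTop :=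
    Nat.hyperfilter_le_atTop
  have hgy : ∀ i, g i y = 1 := fun i => by
    refine tendsto_nhds_unique (hlim (g i)) (tendsto_const_nhds.congr' ?_)
    filter_upwards [hle (eventually_ge_atTop i)] with j hj
    simp [hgx, show i ≤ j from hj]
  have hfx : ∀ j, f (x j) = 0 := fun j => by
    refine tendsto_nhds_unique (hf (x j)) (tendsto_const_nhds.congr' ?_)
    filter_upwards [hle (eventually_gt_atTop j)] with i hi
    simp [hgx, not_le.2 (show j < i from hi)]
  -- The two iterated limits of `g i (x j)` both compute `f y`.
  have h1 : f y = 1 := tendsto_nhds_unique (hf y) (by simp [hgy])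
  have h0 : f y = 0 := tendsto_nhds_unique (hlim f) (by simp [hfx])
  exact one_ne_zero (h1.symm.trans h0)

/-- A family of functionals of norm at most one acts on the ultrapower by limits along the
ultrafilter. -/
theorem exists_ultrapower_functional {I X : Type*} [NormedAddCommGroup X] [NormedSpace ℝ X]
    (U : Ultrafilter I) (φ : I → StrongDual ℝ X) (hφ : ∀ i, ‖φ i‖ ≤ 1) :
    ∃ f : StrongDual ℝ (BanachUltrapower X U), ‖f‖ ≤ 1 ∧
      ∀ x : lp (fun _ : I => X) ∞,
        Tendsto (fun i => φ i (x i)) U (𝓝 (f ((nullFamilies X U).mkQ x))) := by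
  have hφx : ∀ i z, ‖φ i z‖ ≤ ‖z‖ := fun i z => by
    simpa using (φ i).le_of_opNorm_le (hφ i) z
  let g : I → StrongDual ℝ (lp (fun _ : I => X) ∞) := fun i =>
    LinearMap.mkContinuous
      { toFun := fun x => φ i (x i)
        map_add' := fun x y => by simp
        map_smul' := fun c x => by simp } 1
      (fun x => by simpa using (hφx i (x i)).trans (lp.norm_apply_le_norm (by simp) x i))
  obtain ⟨f, hf1, hf⟩ := exists_ultrafilter_limit_functional U g
    fun i => LinearMap.mkContinuous_norm_le _ zero_le_one _
  have hker : nullFamilies X U ≤ LinearMap.ker (f : lp (fun _ : I => X) ∞ →ₗ[ℝ] ℝ) := by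
    intro x hx
    exact tendsto_nhds_unique (hf x) (squeeze_zero_norm (fun i => hφx i (x i)) hx)
  refine ⟨LinearMap.mkContinuous ((nullFamilies X U).liftQ _ hker) 1 fun q => ?_,
    LinearMap.mkContinuous_norm_le _ zero_le_one _, fun x => hf x⟩
  rw [one_mul]
  -- The quotient norm is an infimum over representatives; one within ε suffices.
  refine le_of_forall_pos_le_add fun ε hε => ?_
  obtain ⟨x, rfl, hx⟩ := QuotientAddGroup.exists_norm_mk_lt q hε
  exact (by simpa using f.le_of_opNorm_le hf1 x : ‖f x‖ ≤ ‖x‖).trans hx.le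

theorem exists_eval_functional (n : ℕ) :
    ∃ e : StrongDual ℝ C₀(ℕ, ℝ), ‖e‖ ≤ 1 ∧ ∀ h, e h = h n :=
  ⟨LinearMap.mkContinuous
      { toFun := fun h : C₀(ℕ, ℝ) => h n
        map_add' := fun _ _ => rfl
        map_smul' := fun _ _ => rfl } 1
      (fun h => by simpa using h.toBCF.norm_coe_le_norm n),
    LinearMap.mkContinuous_norm_le _ zero_le_one _, fun _ => rfl⟩

theorem norm_charFun₀_le (F : Finset ℕ) : ‖charFun₀ F‖ ≤ 1 :=
  (BoundedContinuousFunction.norm_le zero_le_one (f := (charFun₀ F).toBCF)).2 fun n => by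
    change ‖(if n ∈ F then 1 else 0 : ℝ)‖ ≤ 1
    split_ifs <;> simp

/-- Members of a super weakly compact family of finite sets cannot order arbitrarily long
sequences of points. -/
theorem not_isSuperWeaklyCompact_of_order {𝓕 : Set (Finset ℕ)} {a : ℕ → ℕ → ℕ}
    {F : ℕ → ℕ → Finset ℕ} (hF : ∀ n j, F n j ∈ 𝓕)
    (haF : ∀ n i j, i < n → (a n i ∈ F n j ↔ i ≤ j)) :
    ¬ IsSuperWeaklyCompact (charFun₀ '' 𝓕) := by
  rintro ⟨-, h⟩
  let U : Ultrafilter ℕ := hyperfilter ℕ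
  choose e he1 he using exists_eval_functional
  choose g hg1 hg using fun i : ℕ =>
    exists_ultrapower_functional U (fun n => e (a n i)) (fun n => he1 _)
  let x : ℕ → lp (fun _ : ℕ => C₀(ℕ, ℝ)) ∞ := fun j =>
    ⟨fun n => charFun₀ (F n j), memℓp_infty ⟨1, by
      rintro _ ⟨n, rfl⟩
      exact norm_charFun₀_le _⟩⟩
  refine not_isRelativelyWeaklyCompact_of_order
    (S := setUltrapower (charFun₀ '' 𝓕) U) (x := fun j => (nullFamilies _ U).mkQ (x j))
    (fun j => ⟨x j, fun n => ⟨F n j, hF n j, rfl⟩, rfl⟩) hg1 (fun i j => ?_)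
    (h ℕ U hyperfilter_le_cofinite)
  refine tendsto_nhds_unique (hg i (x j)) (tendsto_const_nhds.congr' ?_)
  -- For fixed i, `U`-almost every n exceeds i, so the finite orders merge into an infinite one.
  filter_upwards [Nat.hyperfilter_le_atTop (eventually_gt_atTop i)] with n hn
  rw [he]
  change _ = if a n i ∈ F n j then (1 : ℝ) else 0
  simp only [haF n i j hn]

/-- The members of a family of finite sets cut every initial segment out of an enumeration of a
set that they shatter. -/
theorem exists_order_of_shatters {𝓕 : Set (Finset ℕ)} {s : Finset ℕ}
    (hs : ∀ t ⊆ s, ∃ F ∈ 𝓕, s ∩ F = t) {n : ℕ} (hn : n ≤ s.card) :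
    ∃ (a : ℕ → ℕ) (F : ℕ → Finset ℕ), (∀ j, F j ∈ 𝓕) ∧
      ∀ i j, i < n → (a i ∈ F j ↔ i ≤ j) := by
  obtain ⟨b, hb, hbs⟩ : ∃ b : ℕ → ℕ, Set.InjOn b (Set.Iio n) ∧ ∀ i < n, b i ∈ s := by
    refine ⟨fun i => if h : i < n then s.orderEmbOfFin rfl ⟨i, h.trans_le hn⟩ else 0, ?_, ?_⟩
    · intro i hi j hj hij
      rw [Set.mem_Iio] at hi hj
      simpa [hi, hj] using hij
    · intro i hi
      simp [hi]
  choose F hF hFs using fun j : ℕ =>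
    -- Truncating at n keeps the segment inside `s` even when j ≥ n.
    hs (((Finset.range n).filter (· ≤ j)).image b) (by
      intro m hm
      obtain ⟨i, hi, rfl⟩ := Finset.mem_image.1 hm
      exact hbs i (by simpa using (Finset.mem_filter.1 hi).1))
  refine ⟨b, F, hF, fun i j hi => ?_⟩
  have h : b i ∈ F j ↔ b i ∈ ((Finset.range n).filter (· ≤ j)).image b := by
    rw [← hFs j, Finset.mem_inter, and_iff_right (hbs i hi)]
  rw [h, Finset.mem_image]
  constructor
  · rintro ⟨k, hk, hki⟩
    rw [Finset.mem_filter, Finset.mem_range] at hk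
    exact hb hk.1 hi hki ▸ hk.2
  · exact fun hij => ⟨i, by simp [hi, hij], rfl⟩

/-- The Sauer–Shelah bound for the traces of a family of finite sets. -/
theorem ncard_trace_le_of_shatters_card_le {α : Type*} [DecidableEq α] {𝓕 : Set (Finset α)}
    {d : ℕ} (hd : ∀ s : Finset α, (∀ t ⊆ s, ∃ F ∈ 𝓕, s ∩ F = t) → s.card ≤ d)
    {A : Finset α} (hA : A.Nonempty) :
    ((fun F : Finset α => F ∩ A) '' 𝓕).ncard ≤ (d + 1) * A.card ^ d := by
  have hfin : ((fun F : Finset α => F ∩ A) '' 𝓕).Finite :=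
    A.powerset.finite_toSet.subset (by
      rintro _ ⟨F, -, rfl⟩
      simp)
  rw [Set.ncard_eq_toFinset_card _ hfin]
  have hsub : hfin.toFinset.shatterer ⊆
      (Finset.range (d + 1)).biUnion fun k => A.powersetCard k := by
    intro s hs
    rw [Finset.mem_shatterer] at hs
    have hsA : s ⊆ A := by
      obtain ⟨_, hu, hsu⟩ := hs subset_rfl
      obtain ⟨F, -, rfl⟩ := hfin.mem_toFinset.1 hu
      exact (Finset.inter_eq_left.1 hsu).trans Finset.inter_subset_right
    have hsd : s.card ≤ d := hd s fun t ht => by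
      obtain ⟨_, hu, hsu⟩ := hs ht
      obtain ⟨F, hF, rfl⟩ := hfin.mem_toFinset.1 hu
      -- Since `s ⊆ A`, a set shattered by the traces is shattered by `𝓕` itself.
      refine ⟨F, hF, ?_⟩
      rw [← hsu]
      change s ∩ F = s ∩ (F ∩ A)
      rw [Finset.inter_comm F A, ← Finset.inter_assoc, Finset.inter_eq_left.2 hsA]
    simp only [Finset.mem_biUnion, Finset.mem_range, Finset.mem_powersetCard]
    exact ⟨s.card, by omega, hsA, rfl⟩
  calc hfin.toFinset.card ≤ hfin.toFinset.shatterer.card := Finset.card_le_card_shatterer _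
    _ ≤ _ := Finset.card_le_card hsub
    _ ≤ (Finset.range (d + 1)).card * A.card ^ d := by
        refine Finset.card_biUnion_le_card_mul _ _ _ fun k hk => ?_
        rw [Finset.card_powersetCard]
        -- Raising the exponent from k to d needs |A| ≥ 1.
        exact (Nat.choose_le_pow _ _).trans (Nat.pow_le_pow_right hA.card_pos
          (Nat.lt_succ_iff.1 (Finset.mem_range.1 hk)))
    _ = _ := by rw [Finset.card_range]

theorem proposition6p5 (𝓕 : Set (Finset ℕ))
    (h𝓕 : IsSuperWeaklyCompact (charFun₀ '' 𝓕)) :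
    ∃ p : ℕ, ∃ C : ℝ, 0 < C ∧
      ∀ A : Finset ℕ, A.Nonempty →
        (((fun F : Finset ℕ => F ∩ A) '' 𝓕).ncard : ℝ) ≤ C * (A.card : ℝ) ^ p := by
  obtain ⟨d, hd⟩ : ∃ d : ℕ, ∀ s : Finset ℕ,
      (∀ t ⊆ s, ∃ F ∈ 𝓕, s ∩ F = t) → s.card ≤ d := by
    by_contra! h
    choose s hs hcard using h
    choose a F hF haF using fun n => exists_order_of_shatters (hs n) (hcard n).le
    exact not_isSuperWeaklyCompact_of_order hF haF h𝓕
  refine ⟨d, d + 1, by positivity, fun A hA => ?_⟩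
  exact_mod_cast ncard_trace_le_of_shatters_card_le hd hA
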